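/- Let $P$ be a finite partially ordered set with $n$ elements. A subset $J\subseteq P$ is an order ideal if $j\in J$ and $i\le_P j$ imply $i\in J$; it is a connected order ideal if moreover it is non-empty and its Hasse diagram is a connected graph. Let $G_P$ be the simple graph whose vertices are the connected order ideals of $P$, two of them, $J_a$ and $J_b$, being adjacent if and only if $J_a\cap J_b\neq\emptyset$, $J_a\not\subseteq J_b$ and $J_b\not\subseteq J_a$. Let $C_1,\dots,C_h$ be the connected components of $G_P$, and let $\mathscr{M}(C_r)$ be the set of maximum independent sets of $C_r$, that is, of the independent sets of $C_r$ with the largest possible number of vertices. Label the elements of $P$ by $1,\dots,n$ through an arbitrary bijection (not necessarily a natural labeling), and let $\mathcal{L}(P)$ be the set of linear extensions of $P$: the permutations $w=w_1w_2\cdots w_n$ of $\{1,\dots,n\}$ such that $i<j$ whenever $w_i<_P w_j$. Then $$|\mathcal{L}(P)|=n!\prod_{r=1}^{h}\ \sum_{M_r\in\mathscr{M}(C_r)}\frac{1}{\prod_{J\in M_r}|J|}.$$ In particular, the number of linear extensions does not depend on the labeling. -/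

import Mathlib

namespace PosetCount

/-- The connected order ideals of `P`: the down-sets `J` whose Hasse diagram (as an induced
subposet) is a connected graph. Connectedness of a graph includes non-emptiness. -/
abbrev ConnIdeal (P : Type*) [PartialOrder P] : Type _ :=
  {J : Set P // IsLowerSet J ∧ (SimpleGraph.hasse J).Connected}

/-- The graph `G_P` on the connected order ideals of `P`: two of them are adjacent iff they
have nonempty intersection and are incomparable with respect to inclusion. -/
def idealGraph (P : Type*) [PartialOrder P] : SimpleGraph (ConnIdeal P) where
  Adj A B := (A.1 ∩ B.1).Nonempty ∧ ¬ A.1 ⊆ B.1 ∧ ¬ B.1 ⊆ A.1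
  symm := ⟨fun A B h => ⟨by rw [Set.inter_comm]; exact h.1, h.2.2, h.2.1⟩⟩
  loopless := ⟨fun _ h => h.2.1 subset_rfl⟩

noncomputable instance instFintypeComponents (P : Type*) [PartialOrder P] [Finite P] :
    Fintype (idealGraph P).ConnectedComponent :=
  Fintype.ofFinite _

open Classical in
/-- The set of maximum independent sets (independent sets of largest possible size)
of a finite graph. -/
noncomputable def maxIndepSets {V : Type*} [Finite V] (G : SimpleGraph V) :
    Finset (Finset V) :=
  letI := Fintype.ofFinite V
  Finset.univ.filter fun M => G.IsMaximumIndepSet M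

/-- The linear extensions of `P`, labelled by `{0, …, n - 1}` through `ω`: the permutations
`w` of the labels such that `i < j` whenever the element labelled `w i` is smaller in `P` than
the element labelled `w j`. -/
def linearExtensions {P : Type*} [PartialOrder P] {n : ℕ} (ω : P ≃ Fin n) :
    Set (Equiv.Perm (Fin n)) :=
  {w | ∀ i j : Fin n, ω.symm (w i) < ω.symm (w j) → i < j}

end PosetCount

/-!
Removing the last element of a linear extension shows that the number `e(I)` of linear extensions
of a lower set `I` is the sum of `e(I ∖ x)` over the maximal elements `x` of `I`. Let `S(I)` be the
sum of `∏ 1/|J|` over the independent sets of `G_P` that consist of `|I|` subsets of `I`. It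
satisfies `|I| S(I) = ∑ₓ S(I ∖ x)`, hence `e(I) = |I|! S(I)`.

The reason is that every member `J` of an independent set has a point that lies in no smaller
member: `J` is connected, so it is not a disjoint union of smaller ideals. Consequently `|I|` is the
largest size of an independent set of subsets of `I`. In one of that size the maximal members are
the components of `I`, so their sizes add up to `|I|`, and deleting one of them, `R`, leaves an
independent set of size `|I| - 1` on `I` without a maximal element `x` of `I`; the weight `1/|R|` is
cancelled by the contribution of `R` to `|I|`. For `I = P` these are the maximum independent sets
of `G_P`, which are the unions of maximum independent sets of its components.
-/

namespace PosetCount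

section GraphComponents

theorem isMaxOn_sum_univ_pi_iff {ι M : Type*} [Fintype ι] [AddCommMonoid M] [PartialOrder M]
    [IsOrderedCancelAddMonoid M] {α : ι → Type*} {s : ∀ i, Set (α i)} {f : ∀ i, α i → M}
    {a : ∀ i, α i} (ha : a ∈ Set.univ.pi s) :
    IsMaxOn (fun b => ∑ i, f i (b i)) (Set.univ.pi s) a ↔ ∀ i, IsMaxOn (f i) (s i) (a i) := by
  classical
  refine ⟨fun h i => isMaxOn_iff.2 fun c hc => ?_, fun h => isMaxOn_iff.2 fun b hb =>
    Finset.sum_le_sum fun i _ => isMaxOn_iff.1 (h i) (b i) (hb i (Set.mem_univ i))⟩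
  have hle := isMaxOn_iff.1 h (Function.update a i c) ((Set.update_mem_pi_iff_of_mem ha).2
    fun _ => hc)
  have hrest : ∀ j ∈ Finset.univ.erase i, f j (Function.update a i c j) = f j (a j) :=
    fun j hj => by rw [Function.update_of_ne (Finset.ne_of_mem_erase hj)]
  rw [← Finset.add_sum_erase _ _ (Finset.mem_univ i), ← Finset.add_sum_erase _ _
    (Finset.mem_univ i), Finset.sum_congr rfl hrest, Function.update_self] at hle
  exact le_of_add_le_add_right hle

variable {V : Type*} {G : SimpleGraph V} [Finite V]

theorem mem_maxIndepSets {M : Finset V} : M ∈ maxIndepSets G ↔ G.IsMaximumIndepSet M := by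
  simp [maxIndepSets]

theorem isMaximumIndepSet_iff_isMaxOn {M : Finset V} :
    G.IsMaximumIndepSet M ↔
      G.IsIndepSet M ∧ IsMaxOn Finset.card {N : Finset V | G.IsIndepSet N} M := by
  rw [SimpleGraph.isMaximumIndepSet_iff, isMaxOn_iff]
  rfl

open Classical in
/-- A finite set of vertices corresponds to the family of its traces on the connected
components of the graph. -/
noncomputable def finsetEquivPiComponents (G : SimpleGraph V) :
    Finset V ≃ ∀ C : G.ConnectedComponent, Finset C where
  toFun M C := M.subtype (· ∈ C)
  invFun p := (Set.toFinite {v | ⟨v, rfl⟩ ∈ p (G.connectedComponentMk v)}).toFinset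
  left_inv M := by
    ext v
    simp
  right_inv p := by
    ext C ⟨v, rfl⟩
    simp

theorem mem_finsetEquivPiComponents {M : Finset V} {C : G.ConnectedComponent} {v : C} :
    v ∈ finsetEquivPiComponents G M C ↔ (v : V) ∈ M := by
  simp [finsetEquivPiComponents]

@[to_additive]
theorem prod_finsetEquivPiComponents [Fintype G.ConnectedComponent] {R : Type*} [CommMonoid R]
    (w : V → R) (M : Finset V) :
    ∏ C, ∏ v ∈ finsetEquivPiComponents G M C, w v = ∏ v ∈ M, w v := by
  classical
  rw [← Finset.prod_fiberwise M G.connectedComponentMk w]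
  exact Finset.prod_congr rfl fun C _ => Finset.prod_subtype_eq_prod_filter w

theorem sum_card_finsetEquivPiComponents [Fintype G.ConnectedComponent] (M : Finset V) :
    ∑ C, (finsetEquivPiComponents G M C).card = M.card := by
  simp only [Finset.card_eq_sum_ones, sum_finsetEquivPiComponents (fun _ => 1)]

theorem isIndepSet_iff_finsetEquivPiComponents {M : Finset V} :
    G.IsIndepSet M ↔
      ∀ C : G.ConnectedComponent,
        C.toSimpleGraph.IsIndepSet (finsetEquivPiComponents G M C : Set C) := by
  refine ⟨fun h C u hu v hv huv => h (mem_finsetEquivPiComponents.1 hu)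
    (mem_finsetEquivPiComponents.1 hv) (Subtype.coe_injective.ne huv),
    fun h u hu v hv huv hadj => ?_⟩
  have hvu : v ∈ G.connectedComponentMk u :=
    SimpleGraph.ConnectedComponent.sound hadj.symm.reachable
  exact h (G.connectedComponentMk u) (x := ⟨u, rfl⟩) (mem_finsetEquivPiComponents.2 hu)
    (y := ⟨v, hvu⟩) (mem_finsetEquivPiComponents.2 hv) (huv ∘ congrArg Subtype.val) hadj

theorem isMaximumIndepSet_iff_finsetEquivPiComponents {M : Finset V} :
    G.IsMaximumIndepSet M ↔
      ∀ C : G.ConnectedComponent,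
        C.toSimpleGraph.IsMaximumIndepSet (finsetEquivPiComponents G M C) := by
  have := Fintype.ofFinite G.ConnectedComponent
  let S (C : G.ConnectedComponent) : Set (Finset C) := {N | C.toSimpleGraph.IsIndepSet N}
  have hS (N : Finset V) : G.IsIndepSet N ↔ finsetEquivPiComponents G N ∈ Set.univ.pi S := by
    simp only [isIndepSet_iff_finsetEquivPiComponents (G := G), Set.mem_univ_pi, S,
      Set.mem_ofPred_eq]
  have hmax : IsMaxOn Finset.card {N : Finset V | G.IsIndepSet N} M ↔
      IsMaxOn (fun p => ∑ C, (p C).card) (Set.univ.pi S) (finsetEquivPiComponents G M) := by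
    simp only [isMaxOn_iff, Set.mem_ofPred_eq, hS, ← (finsetEquivPiComponents G).forall_congr_right,
      sum_card_finsetEquivPiComponents]
  simp only [isMaximumIndepSet_iff_isMaxOn, forall_and]
  rw [← isIndepSet_iff_finsetEquivPiComponents, hmax]
  exact and_congr_right fun hM => isMaxOn_sum_univ_pi_iff ((hS M).1 hM)

theorem sum_maxIndepSets_eq_prod_components [Fintype G.ConnectedComponent] {R : Type*}
    [CommSemiring R] (w : V → R) :
    ∑ M ∈ maxIndepSets G, ∏ v ∈ M, w v =
      ∏ C : G.ConnectedComponent, ∑ M ∈ maxIndepSets C.toSimpleGraph, ∏ v ∈ M, w v := by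
  classical
  rw [Finset.prod_univ_sum]
  refine Finset.sum_equiv (finsetEquivPiComponents G) (fun M => ?_)
    fun M _ => (prod_finsetEquivPiComponents w M).symm
  simp only [Fintype.mem_piFinset, mem_maxIndepSets,
    isMaximumIndepSet_iff_finsetEquivPiComponents (G := G)]

end GraphComponents

section ReverseLinearExtensions

open Classical in
/-- The maximal elements of a finite subset, as a finite set to sum over. -/
noncomputable def maximalElements {α : Type*} [LE α] (I : Finset α) : Finset α :=
  {x ∈ I | Maximal (· ∈ I) x}

theorem mem_maximalElements {α : Type*} [LE α] {I : Finset α} {x : α} :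
    x ∈ maximalElements I ↔ Maximal (· ∈ I) x := by
  simpa [maximalElements] using Maximal.prop

theorem maximalElements_subset {α : Type*} [LE α] {I : Finset α} : maximalElements I ⊆ I :=
  fun _ hx => (mem_maximalElements.1 hx).prop

variable {P : Type*} [Preorder P]

open Classical in
/-- The linear extensions of the subposet `I`, written as lists of its elements in reverse order,
so that the head of a list is a maximal element of `I`. -/
noncomputable def reverseLinearExtensions (I : Finset P) : Finset (List P) :=
  {l ∈ I.val.lists.toFinset | l.Pairwise (¬ · < ·)}

theorem mem_reverseLinearExtensions {I : Finset P} {l : List P} :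
    l ∈ reverseLinearExtensions I ↔ (l : Multiset P) = I.val ∧ l.Pairwise (¬ · < ·) := by
  simp [reverseLinearExtensions, Multiset.mem_lists_iff, eq_comm]

theorem reverseLinearExtensions_empty :
    reverseLinearExtensions (∅ : Finset P) = {[]} := by
  ext l
  simp +contextual [mem_reverseLinearExtensions]

theorem cons_mem_reverseLinearExtensions [DecidableEq P] {I : Finset P} {x : P} {l : List P} :
    x :: l ∈ reverseLinearExtensions I ↔
      x ∈ maximalElements I ∧ l ∈ reverseLinearExtensions (I.erase x) := by
  have hcons : ((x :: l : List P) : Multiset P) = I.val ↔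
      x ∈ I ∧ (l : Multiset P) = (I.erase x).val := by
    rw [← Multiset.cons_coe, Finset.erase_val]
    constructor
    · intro h
      exact ⟨Finset.mem_def.2 (h ▸ Multiset.mem_cons_self x _), by
        rw [← h, Multiset.erase_cons_head]⟩
    · rintro ⟨hx, h⟩
      rw [h, Multiset.cons_erase (Finset.mem_def.1 hx)]
  have hmax (hx : x ∈ I) (hl : (l : Multiset P) = (I.erase x).val) :
      (∀ y ∈ l, ¬ x < y) ↔ Maximal (· ∈ I) x := by
    have hmem (y : P) : y ∈ l ↔ y ≠ x ∧ y ∈ I := by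
      rw [← Multiset.mem_coe, hl, Finset.mem_val, Finset.mem_erase]
    simp only [maximal_iff_forall_gt, hmem, hx, true_and]
    exact ⟨fun h y hxy hy => h y ⟨hxy.ne', hy⟩ hxy, fun h y hy hxy => h hxy hy.2⟩
  simp only [mem_reverseLinearExtensions, mem_maximalElements, hcons, List.pairwise_cons]
  constructor
  · rintro ⟨⟨hx, hl⟩, hle, hp⟩
    exact ⟨(hmax hx hl).1 hle, hl, hp⟩
  · rintro ⟨hx, hl, hp⟩
    exact ⟨⟨hx.prop, hl⟩, (hmax hx.prop hl).2 hx, hp⟩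

theorem card_reverseLinearExtensions_eq_sum [DecidableEq P] {I : Finset P} (hI : I.Nonempty) :
    (reverseLinearExtensions I).card =
      ∑ x ∈ maximalElements I, (reverseLinearExtensions (I.erase x)).card := by
  rw [← Finset.card_sigma]
  symm
  refine Finset.card_nbij (fun a => a.1 :: a.2) (fun a ha => ?_) ?_ ?_
  · exact cons_mem_reverseLinearExtensions.2 (Finset.mem_sigma.1 ha)
  · rintro ⟨x, l⟩ - ⟨y, m⟩ - h
    obtain ⟨rfl, rfl⟩ := List.cons.inj h
    rfl
  · rintro (_ | ⟨x, l⟩) hl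
    · have hval := (mem_reverseLinearExtensions.1 hl).1
      exact absurd (Finset.val_eq_zero.1 hval.symm) hI.ne_empty
    · exact ⟨⟨x, l⟩, Finset.mem_sigma.2 (cons_mem_reverseLinearExtensions.1 hl), rfl⟩

theorem ofFn_mem_reverseLinearExtensions_univ [Fintype P] {n : ℕ} {f : Fin n → P} :
    List.ofFn f ∈ reverseLinearExtensions Finset.univ ↔
      f.Bijective ∧ ∀ i j, i < j → ¬ f i < f j := by
  rw [mem_reverseLinearExtensions, ← Fin.univ_val_map, Multiset.bijective_iff_map_univ_eq_univ,
    List.pairwise_ofFn]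

end ReverseLinearExtensions

section LinearExtensions

variable {P : Type*} [PartialOrder P]

theorem isLowerSet_erase [DecidableEq P] {I : Finset P} {x : P}
    (hI : IsLowerSet (I : Set P)) (hx : Maximal (· ∈ I) x) : IsLowerSet (I.erase x : Set P) := by
  rw [Finset.coe_erase]
  exact hI.erase fun y hy hxy => (hx.eq_of_le hy hxy).symm

theorem card_reverseLinearExtensions_eq_factorial_mul [DecidableEq P] {R : Type*}
    [CommSemiring R] {f : Finset P → R} (hf_empty : f ∅ = 1)
    (hf : ∀ I : Finset P, IsLowerSet (I : Set P) →
      I.card * f I = ∑ x ∈ maximalElements I, f (I.erase x))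
    {I : Finset P} (hI : IsLowerSet (I : Set P)) :
    ((reverseLinearExtensions I).card : R) = I.card.factorial * f I := by
  induction I using Finset.strongInduction with
  | H I ih =>
    rcases I.eq_empty_or_nonempty with rfl | hne
    · simp [reverseLinearExtensions_empty, hf_empty]
    have herase : ∀ x ∈ maximalElements I, ((reverseLinearExtensions (I.erase x)).card : R) =
        (I.card - 1).factorial * f (I.erase x) := fun x hx => by
      have hxI := maximalElements_subset hx
      rw [ih _ (Finset.erase_ssubset hxI) (isLowerSet_erase hI (mem_maximalElements.1 hx)),
        Finset.card_erase_of_mem hxI]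
    rw [card_reverseLinearExtensions_eq_sum hne, Nat.cast_sum, Finset.sum_congr rfl herase,
      ← Finset.mul_sum, ← hf I hI, ← Nat.mul_factorial_pred hne.card_ne_zero, Nat.cast_mul]
    ring

theorem mem_linearExtensions_iff_ofFn [Fintype P] {n : ℕ} {ω : P ≃ Fin n}
    {w : Equiv.Perm (Fin n)} :
    w ∈ linearExtensions ω ↔
      List.ofFn (fun i => ω.symm (w i.rev)) ∈ reverseLinearExtensions Finset.univ := by
  have hbij : Function.Bijective fun i : Fin n => ω.symm (w i.rev) :=
    ω.symm.bijective.comp (w.bijective.comp Fin.revPerm.bijective)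
  rw [ofFn_mem_reverseLinearExtensions_univ, and_iff_right hbij]
  refine ⟨fun hw i j hij hlt => (Fin.rev_lt_rev.1 (hw _ _ hlt)).not_gt hij,
    fun h i j hlt => ?_⟩
  by_contra! hji
  rcases hji.eq_or_lt with rfl | hji
  · exact lt_irrefl _ hlt
  · exact h i.rev j.rev (Fin.rev_lt_rev.2 hji) (by simpa only [Fin.rev_rev] using hlt)

theorem ncard_linearExtensions [Fintype P] {n : ℕ} (ω : P ≃ Fin n) :
    (linearExtensions ω).ncard = (reverseLinearExtensions (Finset.univ : Finset P)).card := by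
  have hinj : Function.Injective fun w : Equiv.Perm (Fin n) =>
      List.ofFn fun i => ω.symm (w i.rev) := fun v w h => by
    ext1 i
    simpa using congrFun (List.ofFn_injective h) i.rev
  rw [← Set.ncard_coe_finset, ← Set.ncard_image_of_injective _ hinj]
  congr 1
  ext l
  refine ⟨?_, fun hl => ?_⟩
  · rintro ⟨w, hw, rfl⟩
    exact mem_linearExtensions_iff_ofFn.1 hw
  · have hlen : l.length = n := by
      rw [← Multiset.coe_card, (mem_reverseLinearExtensions.1 hl).1, Finset.card_val,
        Finset.card_univ, Fintype.card_congr ω, Fintype.card_fin]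
    subst hlen
    have hbij : l.get.Bijective :=
      (ofFn_mem_reverseLinearExtensions_univ.1 (by rwa [List.ofFn_get])).1
    let w := Fin.revPerm.trans ((Equiv.ofBijective _ hbij).trans ω)
    have hw : List.ofFn (fun i => ω.symm (w i.rev)) = l := by
      simp [w]
    exact ⟨w, mem_linearExtensions_iff_ofFn.2 (by rwa [hw]), hw⟩

end LinearExtensions

section HasseConnected

theorem reachable_hasse_of_le {Q : Type*} [PartialOrder Q] [LocallyFiniteOrder Q] {a b : Q}
    (h : a ≤ b) : (SimpleGraph.hasse Q).Reachable a b :=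
  (SimpleGraph.reachable_iff_reflTransGen a b).2
    (Relation.ReflTransGen.mono (fun _ _ => Or.inl) a b (le_iff_reflTransGen_covBy.1 h))

instance instIsLowerSetSubtype {P : Type*} [Preorder P] [TopologicalSpace P] [Topology.IsLowerSet P]
    (J : Set P) : Topology.IsLowerSet J := by
  refine Topology.isLowerSet_iff_nhds.2 fun x => ?_
  rw [nhds_subtype, Topology.IsLowerSet.nhds_eq_principal_Iic, Filter.comap_principal]
  rfl

theorem hasse_connected_iff_connectedSpace {Q : Type*} [PartialOrder Q] [LocallyFiniteOrder Q]
    [TopologicalSpace Q] [Topology.IsLowerSet Q] :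
    (SimpleGraph.hasse Q).Connected ↔ ConnectedSpace Q := by
  constructor
  · intro h
    have hjoined_of_le {a b : Q} (hab : a ≤ b) : Joined a b :=
      ((Topology.IsLowerSet.specializes_iff_le.2 hab).joinedIn (Set.mem_univ a)
        (Set.mem_univ b)).joined
    have hjoined {a b : Q} (p : (SimpleGraph.hasse Q).Walk a b) : Joined a b := by
      induction p with
      | nil => exact Joined.refl _
      | cons hadj _ ih =>
        exact (hadj.elim (fun hab => hjoined_of_le hab.le)
          fun hba => (hjoined_of_le hba.le).symm).trans ih
    have : PathConnectedSpace Q := ⟨h.nonempty, fun a b => hjoined (h.preconnected a b).some⟩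
    infer_instance
  · intro h
    refine (SimpleGraph.connected_iff _).2 ⟨fun a b => ?_, h.toNonempty⟩
    refine PreconnectedSpace.induction₂' (SimpleGraph.hasse Q).Reachable (fun x => ?_)
      ⟨fun _ _ _ => SimpleGraph.Reachable.trans⟩ a b
    rw [Topology.IsLowerSet.nhds_eq_principal_Iic]
    exact Filter.eventually_principal.2 fun y hyx =>
      ⟨(reachable_hasse_of_le hyx).symm, reachable_hasse_of_le hyx⟩

theorem hasse_connected_iff_isConnected {P : Type*} [PartialOrder P]
    [TopologicalSpace P] [Topology.IsLowerSet P] {J : Set P} [Finite J] :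
    (SimpleGraph.hasse J).Connected ↔ IsConnected J := by
  classical
  have := Fintype.ofFinite J
  let _ : LocallyFiniteOrder J := Fintype.toLocallyFiniteOrder
  rw [hasse_connected_iff_connectedSpace, isConnected_iff_connectedSpace]

end HasseConnected

section ComponentIdeal

variable {P : Type*} [PartialOrder P]

theorem ConnIdeal.nonempty (J : ConnIdeal P) : J.1.Nonempty :=
  Set.nonempty_coe_sort.1 J.2.2.nonempty

variable [Finite P]

/-- The connected component of `x` in the lower set `I`, taken in the topology whose open sets are
the lower sets. -/
def componentIdeal {I : Set P} (hI : IsLowerSet I) {x : P} (hx : x ∈ I) : ConnIdeal P :=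
  letI := Topology.lowerSet P
  haveI : Topology.IsLowerSet P := ⟨rfl⟩
  ⟨connectedComponentIn I x,
    Topology.IsLowerSet.isOpen_iff_isLowerSet.1
      (Topology.IsLowerSet.isOpen_iff_isLowerSet.2 hI).connectedComponentIn,
    hasse_connected_iff_isConnected.2 (isConnected_connectedComponentIn_iff.2 hx)⟩

variable {I : Set P} (hI : IsLowerSet I) {x : P} (hx : x ∈ I)

theorem mem_componentIdeal : x ∈ (componentIdeal hI hx).1 :=
  letI := Topology.lowerSet P
  mem_connectedComponentIn hx

theorem componentIdeal_subset : (componentIdeal hI hx).1 ⊆ I :=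
  letI := Topology.lowerSet P
  connectedComponentIn_subset I x

theorem le_componentIdeal {J : ConnIdeal P} (hJI : J.1 ⊆ I)
    (hJ : (J.1 ∩ (componentIdeal hI hx).1).Nonempty) : J ≤ componentIdeal hI hx := by
  let := Topology.lowerSet P
  have : Topology.IsLowerSet P := ⟨rfl⟩
  obtain ⟨y, hyJ, hy⟩ := hJ
  have hJy : J.1 ⊆ connectedComponentIn I y :=
    (hasse_connected_iff_isConnected.1 J.2.2).isPreconnected.subset_connectedComponentIn hyJ hJI
  rwa [← connectedComponentIn_eq hy] at hJy

end ComponentIdeal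

section NestedSets

variable {P : Type*} [PartialOrder P]

theorem isIndepSet_idealGraph_iff {M : Set (ConnIdeal P)} :
    (idealGraph P).IsIndepSet M ↔
      ∀ A ∈ M, ∀ B ∈ M, (A.1 ∩ B.1).Nonempty → A ≤ B ∨ B ≤ A := by
  constructor
  · intro h A hA B hB hAB
    by_contra! hn
    exact h hA hB (fun e => hn.1 e.le) ⟨hAB, hn.1, hn.2⟩
  · intro h A hA B hB _ hadj
    exact (h A hA B hB hadj.1).elim hadj.2.1 hadj.2.2

theorem eq_of_maximal_of_isIndepSet {M : Set (ConnIdeal P)} (hM : (idealGraph P).IsIndepSet M)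
    {A B : ConnIdeal P} (hA : Maximal (· ∈ M) A) (hB : Maximal (· ∈ M) B)
    (hAB : (A.1 ∩ B.1).Nonempty) : A = B :=
  (isIndepSet_idealGraph_iff.1 hM A hA.prop B hB.prop hAB).elim (hA.eq_of_le hB.prop)
    fun h => (hB.eq_of_le hA.prop h).symm

theorem iUnion_maximalElements (M : Finset (ConnIdeal P)) :
    ⋃ R ∈ maximalElements M, R.1 = ⋃ J ∈ M, J.1 := by
  refine Set.Subset.antisymm (Set.biUnion_subset_biUnion_left fun R hR =>
    maximalElements_subset hR) (Set.iUnion₂_subset fun J hJ => ?_)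
  obtain ⟨R, hJR, hR⟩ := M.exists_le_maximal hJ
  exact (Subtype.coe_le_coe.2 hJR).trans
    (Set.subset_iUnion₂_of_subset R (mem_maximalElements.2 hR) subset_rfl)

variable [Finite P] {M : Finset (ConnIdeal P)}

theorem exists_le_of_subset_iUnion (hM : (idealGraph P).IsIndepSet (M : Set (ConnIdeal P)))
    {J : ConnIdeal P} (hJ : J.1 ⊆ ⋃ K ∈ M, K.1) : ∃ K ∈ M, J ≤ K := by
  classical
  let := Topology.lowerSet P
  have : Topology.IsLowerSet P := ⟨rfl⟩
  have hconn : IsConnected J.1 := hasse_connected_iff_isConnected.1 J.2.2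
  let U : Finset (Set P) := (maximalElements M).image Subtype.val
  have hdisj : ∀ A B : Set P, A ∈ U → B ∈ U → (J.1 ∩ (A ∩ B)).Nonempty → A = B := by
    simp only [U, Finset.mem_image, mem_maximalElements]
    rintro _ _ ⟨A, hA, rfl⟩ ⟨B, hB, rfl⟩ hAB
    exact congrArg _ (eq_of_maximal_of_isIndepSet hM hA hB hAB.right)
  have hopen : ∀ A ∈ U, IsOpen A :=
    Finset.forall_mem_image.2 fun R _ => Topology.IsLowerSet.isOpen_iff_isLowerSet.2 R.2.1
  have hJU : J.1 ⊆ ⋃₀ U := by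
    rw [Finset.coe_image, Set.sUnion_image]
    exact hJ.trans_eq (iUnion_maximalElements M).symm
  obtain ⟨A, hA, hJA⟩ := isConnected_iff_sUnion_disjoint_open.1 hconn U hdisj hopen hJU
  obtain ⟨R, hR, rfl⟩ := Finset.mem_image.1 hA
  exact ⟨R, maximalElements_subset hR, hJA⟩

theorem exists_isLeast_mem (hM : (idealGraph P).IsIndepSet (M : Set (ConnIdeal P)))
    {J : ConnIdeal P} (hJ : J ∈ M) : ∃ x, IsLeast {K | K ∈ M ∧ x ∈ K.1} J := by
  classical
  by_contra! hcon
  -- Otherwise the maximal members of `M` below `J` split `J` into disjoint lower sets.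
  let S : Finset (ConnIdeal P) := {K ∈ M | K < J}
  have hS : (idealGraph P).IsIndepSet (S : Set (ConnIdeal P)) :=
    hM.mono (Finset.coe_subset.2 (Finset.filter_subset _ _))
  have hcover : J.1 ⊆ ⋃ K ∈ S, K.1 := fun x hx => by
    obtain ⟨K, ⟨hK, hxK⟩, hJK⟩ : ∃ K, (K ∈ M ∧ x ∈ K.1) ∧ ¬ J ≤ K := by
      by_contra! h
      exact hcon x ⟨⟨hJ, hx⟩, h⟩
    have hKJ := (isIndepSet_idealGraph_iff.1 hM J hJ K hK ⟨x, hx, hxK⟩).resolve_left hJK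
    exact Set.mem_iUnion₂_of_mem (Finset.mem_filter.2 ⟨hK, lt_of_le_not_ge hKJ hJK⟩) hxK
  obtain ⟨K, hK, hJK⟩ := exists_le_of_subset_iUnion hS hcover
  exact (Finset.mem_filter.1 hK).2.not_ge hJK

theorem exists_injOn_isLeast_mem (hM : (idealGraph P).IsIndepSet (M : Set (ConnIdeal P))) :
    ∃ t : ConnIdeal P → P, (∀ J ∈ M, IsLeast {K | K ∈ M ∧ t J ∈ K.1} J) ∧ Set.InjOn t M := by
  have h (J : ConnIdeal P) : ∃ x, J ∈ M → IsLeast {K | K ∈ M ∧ x ∈ K.1} J := by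
    by_cases hJ : J ∈ M
    · exact (exists_isLeast_mem hM hJ).imp fun _ hx _ => hx
    · exact ⟨J.nonempty.some, fun h => absurd h hJ⟩
  choose t ht using h
  refine ⟨t, ht, fun J hJ K hK h => (ht J hJ).unique ?_⟩
  rw [h]
  exact ht K hK

theorem card_le_of_isIndepSet (hM : (idealGraph P).IsIndepSet (M : Set (ConnIdeal P)))
    {I : Finset P} (hI : ∀ J ∈ M, J.1 ⊆ I) : M.card ≤ I.card := by
  obtain ⟨t, ht, hinj⟩ := exists_injOn_isLeast_mem hM
  exact Finset.card_le_card_of_injOn t (fun J hJ => hI J hJ (ht J hJ).1.2) hinj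

theorem isIndepSet_insert_componentIdeal [DecidableEq (ConnIdeal P)] {I : Set P}
    (hI : IsLowerSet I) {x : P} (hx : x ∈ I)
    (hM : (idealGraph P).IsIndepSet (M : Set (ConnIdeal P))) (hMI : ∀ J ∈ M, J.1 ⊆ I) :
    (idealGraph P).IsIndepSet (insert (componentIdeal hI hx) M : Finset (ConnIdeal P)) := by
  rw [Finset.coe_insert]
  have : Std.Symm fun A B => ¬ (idealGraph P).Adj A B := ⟨fun _ _ h hadj => h hadj.symm⟩
  refine Set.pairwise_insert_of_symm.2 ⟨hM, fun J hJ _ hadj => ?_⟩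
  exact hadj.2.2 (le_componentIdeal hI hx (hMI J hJ) (Set.inter_comm _ _ ▸ hadj.1))

end NestedSets

section MaximalNested

variable {P : Type*} [PartialOrder P]

/-- A maximal nested set on `I`: an independent set of `G_P` whose members are contained in `I`,
with as many members as `I` has elements, the largest number possible by `card_le_of_isIndepSet`. -/
structure IsMaximalNested (I : Finset P) (M : Finset (ConnIdeal P)) : Prop where
  isIndepSet : (idealGraph P).IsIndepSet (M : Set (ConnIdeal P))
  subset : ∀ J ∈ M, J.1 ⊆ I
  card_eq : M.card = I.card

namespace IsMaximalNested

variable {I : Finset P} {M N : Finset (ConnIdeal P)} {R : ConnIdeal P} {x : P}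

theorem empty_iff : IsMaximalNested (∅ : Finset P) M ↔ M = ∅ := by
  refine ⟨fun h => Finset.card_eq_zero.1 h.card_eq, ?_⟩
  rintro rfl
  exact ⟨by simp, by simp, rfl⟩

variable [Finite P]

theorem iUnion_eq (hM : IsMaximalNested I M) : ⋃ J ∈ M, J.1 = I := by
  obtain ⟨t, ht, hinj⟩ := exists_injOn_isLeast_mem hM.isIndepSet
  have hsurj : Set.SurjOn t M I := Finset.surjOn_of_injOn_of_card_le t
    (fun J hJ => hM.subset J hJ (ht J hJ).1.2) hinj hM.card_eq.ge
  refine Set.Subset.antisymm (Set.iUnion₂_subset hM.subset) fun x hx => ?_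
  obtain ⟨J, hJ, rfl⟩ := hsurj hx
  exact Set.mem_biUnion hJ (ht J hJ).1.2

theorem isLowerSet (hM : IsMaximalNested I M) : IsLowerSet (I : Set P) :=
  hM.iUnion_eq ▸ isLowerSet_iUnion₂ fun J _ => J.2.1

theorem unique {I' : Finset P} (hM : IsMaximalNested I M) (hM' : IsMaximalNested I' M) :
    I = I' :=
  Finset.coe_injective (hM.iUnion_eq.symm.trans hM'.iUnion_eq)

theorem sum_ncard_maximalElements (hM : IsMaximalNested I M) :
    ∑ R ∈ maximalElements M, R.1.ncard = I.card := by
  have hdisj : (maximalElements M : Set (ConnIdeal P)).PairwiseDisjoint Subtype.val :=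
    fun A hA B hB hAB => Set.disjoint_iff_inter_eq_empty.2 <| Set.not_nonempty_iff_eq_empty.1
      fun h => hAB <| eq_of_maximal_of_isIndepSet hM.isIndepSet (mem_maximalElements.1 hA)
        (mem_maximalElements.1 hB) h
  rw [← finsum_mem_coe_finset, ← (Finset.finite_toSet _).ncard_biUnion
    (fun R _ => R.1.toFinite) hdisj, ← Set.ncard_coe_finset I, ← hM.iUnion_eq,
    ← iUnion_maximalElements]
  rfl

theorem componentIdeal_mem (hM : IsMaximalNested I M) (hx : x ∈ (I : Set P)) :
    componentIdeal hM.isLowerSet hx ∈ M := by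
  classical
  by_contra hn
  have hcard := card_le_of_isIndepSet
    (isIndepSet_insert_componentIdeal hM.isLowerSet hx hM.isIndepSet hM.subset)
    (Finset.forall_mem_insert _ _ _ |>.2 ⟨componentIdeal_subset hM.isLowerSet hx, hM.subset⟩)
  rw [Finset.card_insert_of_notMem hn, hM.card_eq] at hcard
  exact Nat.not_succ_le_self _ hcard

theorem eq_componentIdeal (hM : IsMaximalNested I M) (hR : Maximal (· ∈ M) R)
    (hx : x ∈ (I : Set P)) (hxR : x ∈ R.1) : R = componentIdeal hM.isLowerSet hx :=
  hR.eq_of_le (hM.componentIdeal_mem hx)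
    (le_componentIdeal _ hx (hM.subset R hR.prop) ⟨x, hxR, mem_componentIdeal _ hx⟩)

variable [DecidableEq P]

theorem componentIdeal_notMem (hN : IsMaximalNested (I.erase x) N)
    (hI : IsLowerSet (I : Set P)) (hx : x ∈ (I : Set P)) : componentIdeal hI hx ∉ N :=
  fun h => Finset.notMem_erase x I (hN.subset _ h (mem_componentIdeal hI hx))

variable [DecidableEq (ConnIdeal P)]

theorem insert_componentIdeal (hN : IsMaximalNested (I.erase x) N)
    (hI : IsLowerSet (I : Set P)) (hx : x ∈ (I : Set P)) :
    IsMaximalNested I (insert (componentIdeal hI hx) N) := by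
  have hNI : ∀ J ∈ N, J.1 ⊆ I := fun J hJ =>
    (hN.subset J hJ).trans (Finset.coe_subset.2 (Finset.erase_subset x I))
  refine ⟨isIndepSet_insert_componentIdeal hI hx hN.isIndepSet hNI,
    (Finset.forall_mem_insert _ _ _).2 ⟨componentIdeal_subset hI hx, hNI⟩, ?_⟩
  rw [Finset.card_insert_of_notMem (hN.componentIdeal_notMem hI hx), hN.card_eq,
    Finset.card_erase_add_one hx]

theorem maximal_componentIdeal (hN : IsMaximalNested (I.erase x) N)
    (hI : IsLowerSet (I : Set P)) (hx : x ∈ (I : Set P)) :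
    Maximal (· ∈ insert (componentIdeal hI hx) N) (componentIdeal hI hx) :=
  ⟨Finset.mem_insert_self _ _, fun J hJ hle => le_componentIdeal hI hx
    ((hN.insert_componentIdeal hI hx).subset J hJ)
    ⟨x, hle (mem_componentIdeal hI hx), mem_componentIdeal hI hx⟩⟩

theorem exists_erase (hM : IsMaximalNested I M) (hR : Maximal (· ∈ M) R) :
    ∃ x, Maximal (· ∈ I) x ∧ x ∈ R.1 ∧ IsMaximalNested (I.erase x) (M.erase R) := by
  obtain ⟨x, ⟨-, hxR⟩, hleast⟩ := exists_isLeast_mem hM.isIndepSet hR.prop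
  have hxI : x ∈ I := hM.subset R hR.prop hxR
  have hnotMem : ∀ J ∈ M.erase R, x ∉ J.1 := fun J hJ hxJ =>
    have ⟨hne, hJM⟩ := Finset.mem_erase.1 hJ
    hne (hR.eq_of_le hJM (hleast ⟨hJM, hxJ⟩)).symm
  have herase : IsMaximalNested (I.erase x) (M.erase R) := by
    refine ⟨hM.isIndepSet.mono (Finset.coe_subset.2 (Finset.erase_subset _ _)),
      fun J hJ => ?_, ?_⟩
    · rw [Finset.coe_erase]
      exact Set.subset_sdiff_singleton (hM.subset J (Finset.mem_of_mem_erase hJ)) (hnotMem J hJ)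
    · rw [Finset.card_erase_of_mem hR.prop, Finset.card_erase_of_mem hxI, hM.card_eq]
  refine ⟨x, ⟨hxI, fun y hy hxy => ?_⟩, hxR, herase⟩
  by_contra hyx
  have hy' : y ∈ I.erase x := Finset.mem_erase.2 ⟨fun h => hyx h.le, hy⟩
  exact Finset.notMem_erase x I (herase.isLowerSet hxy hy')

end IsMaximalNested

variable [Finite P] {I : Finset P}

theorem exists_isMaximalNested (hI : IsLowerSet (I : Set P)) : ∃ M, IsMaximalNested I M := by
  classical
  induction I using Finset.strongInduction with
  | H I ih =>
    rcases I.eq_empty_or_nonempty with rfl | hne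
    · exact ⟨∅, IsMaximalNested.empty_iff.2 rfl⟩
    · obtain ⟨x, hx⟩ := I.exists_maximal hne
      obtain ⟨N, hN⟩ := ih _ (Finset.erase_ssubset hx.prop) (isLowerSet_erase hI hx)
      exact ⟨_, hN.insert_componentIdeal hI hx.prop⟩

/-- The maximal nested sets on `I`, as a finite set to sum over. -/
noncomputable def maximalNestedSets (I : Finset P) : Finset (Finset (ConnIdeal P)) :=
  (Set.toFinite {M | IsMaximalNested I M}).toFinset

theorem mem_maximalNestedSets {M : Finset (ConnIdeal P)} :
    M ∈ maximalNestedSets I ↔ IsMaximalNested I M := by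
  simp [maximalNestedSets]

theorem maximalNestedSets_empty : maximalNestedSets (∅ : Finset P) = {∅} := by
  ext M
  rw [mem_maximalNestedSets, IsMaximalNested.empty_iff, Finset.mem_singleton]

/-- The pair `(x, N)` corresponds to `(insert R N, R)` with `R` the component of `x` in `I`;
conversely, `x` is the element of `I` that lies in no member of `M` other than `R`. -/
theorem sum_maximalNestedSets_erase {A : Type*} [AddCommMonoid A] [DecidableEq P]
    [DecidableEq (ConnIdeal P)] (hI : IsLowerSet (I : Set P)) (f : Finset (ConnIdeal P) → A) :
    ∑ x ∈ maximalElements I, ∑ N ∈ maximalNestedSets (I.erase x), f N =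
      ∑ M ∈ maximalNestedSets I, ∑ R ∈ maximalElements M, f (M.erase R) := by
  rw [Finset.sum_sigma', Finset.sum_sigma']
  have hmem : ∀ a ∈ (maximalElements I).sigma fun x => maximalNestedSets (I.erase x),
      a.1 ∈ (I : Set P) := fun a ha => maximalElements_subset (Finset.mem_sigma.1 ha).1
  have hnested : ∀ a ∈ (maximalElements I).sigma fun x => maximalNestedSets (I.erase x),
      IsMaximalNested (I.erase a.1) a.2 := fun a ha =>
    mem_maximalNestedSets.1 (Finset.mem_sigma.1 ha).2
  refine Finset.sum_bij (fun a ha => ⟨insert (componentIdeal hI (hmem a ha)) a.2,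
    componentIdeal hI (hmem a ha)⟩) (fun a ha => ?_) ?_ ?_ fun a ha => ?_
  · exact Finset.mem_sigma.2
      ⟨mem_maximalNestedSets.2 ((hnested a ha).insert_componentIdeal hI (hmem a ha)),
        mem_maximalElements.2 ((hnested a ha).maximal_componentIdeal hI (hmem a ha))⟩
  · rintro ⟨x, N⟩ hxN ⟨y, N'⟩ hyN' h
    obtain ⟨hinsert, hcomponent⟩ := Sigma.mk.inj_iff.1 h
    have hN : componentIdeal hI (hmem _ hxN) ∉ N := (hnested _ hxN).componentIdeal_notMem hI _
    have hN' : componentIdeal hI (hmem _ hyN') ∉ N' := (hnested _ hyN').componentIdeal_notMem hI _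
    obtain rfl : N = N' := by
      rw [← Finset.erase_insert hN, ← Finset.erase_insert hN', hinsert, eq_of_heq hcomponent]
    obtain rfl : x = y := Finset.erase_injOn I (hmem _ hxN) (hmem _ hyN')
      ((hnested _ hxN).unique (hnested _ hyN'))
    rfl
  · rintro ⟨M, R⟩ hMR
    obtain ⟨hM, hR⟩ := (Finset.mem_sigma.1 hMR).imp mem_maximalNestedSets.1 mem_maximalElements.1
    obtain ⟨x, hx, hxR, hN⟩ := hM.exists_erase hR
    refine ⟨⟨x, M.erase R⟩, Finset.mem_sigma.2
      ⟨mem_maximalElements.2 hx, mem_maximalNestedSets.2 hN⟩, ?_⟩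
    simp only [← hM.eq_componentIdeal hR hx.prop hxR, Finset.insert_erase hR.prop]
  · rw [Finset.erase_insert ((hnested a ha).componentIdeal_notMem hI (hmem a ha))]

/-- The sum over the maximal nested sets on `I` of the product of the reciprocals of the sizes of
their members; the analogue for `I` of the right-hand side of the counting formula. -/
noncomputable def nestedSum (I : Finset P) : ℚ :=
  ∑ M ∈ maximalNestedSets I, ∏ J ∈ M, (J.1.ncard : ℚ)⁻¹

theorem nestedSum_empty : nestedSum (∅ : Finset P) = 1 := by
  rw [nestedSum, maximalNestedSets_empty, Finset.sum_singleton, Finset.prod_empty]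

theorem card_mul_nestedSum [DecidableEq P] (hI : IsLowerSet (I : Set P)) :
    I.card * nestedSum I = ∑ x ∈ maximalElements I, nestedSum (I.erase x) := by
  classical
  have hcancel {M : Finset (ConnIdeal P)} {R : ConnIdeal P} (hR : R ∈ maximalElements M) :
      R.1.ncard * ∏ J ∈ M, (J.1.ncard : ℚ)⁻¹ = ∏ J ∈ M.erase R, (J.1.ncard : ℚ)⁻¹ := by
    have hne : (R.1.ncard : ℚ) ≠ 0 :=
      Nat.cast_ne_zero.2 ((Set.ncard_pos R.1.toFinite).2 R.nonempty).ne'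
    rw [← Finset.mul_prod_erase M _ (maximalElements_subset hR), mul_inv_cancel_left₀ hne]
  simp only [nestedSum, sum_maximalNestedSets_erase hI, Finset.mul_sum]
  refine Finset.sum_congr rfl fun M hM => ?_
  rw [← (mem_maximalNestedSets.1 hM).sum_ncard_maximalElements, Nat.cast_sum, Finset.sum_mul]
  exact Finset.sum_congr rfl fun R hR => hcancel hR

end MaximalNested

theorem maxIndepSets_idealGraph {P : Type*} [PartialOrder P] [Fintype P] :
    maxIndepSets (idealGraph P) = maximalNestedSets Finset.univ := by
  ext M
  rw [mem_maxIndepSets, mem_maximalNestedSets]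
  have hle (N : Finset (ConnIdeal P)) (hN : (idealGraph P).IsIndepSet (N : Set (ConnIdeal P))) :
      N.card ≤ (Finset.univ : Finset P).card :=
    card_le_of_isIndepSet hN (by simp)
  constructor
  · intro h
    obtain ⟨N, hN⟩ := exists_isMaximalNested (I := (Finset.univ : Finset P))
      (by simp [isLowerSet_univ])
    exact ⟨h.isIndepSet, by simp,
      (hle M h.isIndepSet).antisymm (hN.card_eq ▸ h.maximum N hN.isIndepSet)⟩
  · intro h
    exact ⟨h.isIndepSet, fun N hN => h.card_eq ▸ hle N hN⟩

end PosetCount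

theorem mainTheorem6 {P : Type*} [PartialOrder P] [Finite P] (n : ℕ) (ω : P ≃ Fin n) :
    ((PosetCount.linearExtensions ω).ncard : ℚ) =
      (n.factorial : ℚ) *
        ∏ C : (PosetCount.idealGraph P).ConnectedComponent,
          ∑ M ∈ PosetCount.maxIndepSets C.toSimpleGraph,
            1 / ∏ J ∈ M, ((J : PosetCount.ConnIdeal P).1.ncard : ℚ) := by
  classical
  have := Fintype.ofFinite P
  have hcard : (Finset.univ : Finset P).card = n := by
    rw [Finset.card_univ, Fintype.card_congr ω, Fintype.card_fin]
  have hcount : ((PosetCount.linearExtensions ω).ncard : ℚ) =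
      n.factorial * PosetCount.nestedSum (Finset.univ : Finset P) := by
    rw [PosetCount.ncard_linearExtensions, ← hcard]
    exact PosetCount.card_reverseLinearExtensions_eq_factorial_mul PosetCount.nestedSum_empty
      (fun _ => PosetCount.card_mul_nestedSum) (by simp [isLowerSet_univ])
  have hprod := PosetCount.sum_maxIndepSets_eq_prod_components (G := PosetCount.idealGraph P)
    fun J => (J.1.ncard : ℚ)⁻¹
  rw [PosetCount.maxIndepSets_idealGraph] at hprod
  simp only [one_div, ← Finset.prod_inv_distrib]
  rw [hcount, PosetCount.nestedSum, hprod]
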